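/- Let $\mathscr{A}$ be a (not necessarily unital) purely infinite simple C*-algebra, i.e. $\mathscr{A}\neq 0$, its only closed two-sided ideals are $0$ and $\mathscr{A}$, and every nonzero hereditary C*-subalgebra of $\mathscr{A}$ contains an infinite projection (a projection that is Murray–von Neumann equivalent to a proper subprojection of itself). Suppose that for every real $\alpha>1$ and every projection $p\in\mathscr{A}$ the element $\alpha p$ is a finite sum of projections of $\mathscr{A}$. Then for all nonzero projections $p,q\in\mathscr{A}$ with $pq=0$ and all real numbers $\alpha>1$ and $\beta\ge 0$, the element $\alpha p+\beta q$ is a finite sum of projections of $\mathscr{A}$. -/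

import Mathlib

/-- `a` is a finite sum of projections (self-adjoint idempotents) of `A`. -/
def IsFiniteSumOfProjections {A : Type*} [NonUnitalCStarAlgebra A] (a : A) : Prop :=
  ∃ (n : ℕ) (r : Fin n → A), (∀ i, IsStarProjection (r i)) ∧ a = ∑ i, r i

/-- Murray-von Neumann equivalence of elements of `A` (meant for projections):
there is `v` with `v* v = p` and `v v* = q`. -/
def MvNEquiv {A : Type*} [NonUnitalCStarAlgebra A] (p q : A) : Prop :=
  ∃ v : A, star v * v = p ∧ v * star v = q

/-- `p` is an infinite projection: it is Murray-von Neumann equivalent to a proper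
subprojection of itself. -/
def IsInfiniteProjection {A : Type*} [NonUnitalCStarAlgebra A] (p : A) : Prop :=
  IsStarProjection p ∧
    ∃ q : A, IsStarProjection q ∧ p * q = q ∧ q ≠ p ∧ MvNEquiv p q

/-- `B` is a hereditary C*-subalgebra of `A`: a norm-closed `*`-subalgebra such that
`0 ≤ a ≤ b` and `b ∈ B` imply `a ∈ B`. -/
def IsHereditaryCStarSubalgebra {A : Type*} [NonUnitalCStarAlgebra A] [PartialOrder A]
    [StarOrderedRing A] (B : NonUnitalStarSubalgebra ℂ A) : Prop :=
  IsClosed (B : Set A) ∧ ∀ a b : A, 0 ≤ a → a ≤ b → b ∈ B → a ∈ B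

/-- `A` is a simple C*-algebra: it is nonzero and its only closed two-sided ideals are
`0` and `A`. -/
def IsSimpleCStarAlgebra (A : Type*) [NonUnitalCStarAlgebra A] : Prop :=
  Nontrivial A ∧
    ∀ I : Submodule ℂ A, IsClosed (I : Set A) →
      (∀ a x : A, x ∈ I → a * x ∈ I ∧ x * a ∈ I) → I = ⊥ ∨ I = ⊤

/-- `A` is a purely infinite simple C*-algebra: it is simple and every nonzero hereditary
C*-subalgebra contains an infinite projection. (A projection of a hereditary subalgebra `B`
is infinite in `B` if and only if it is infinite in `A`: a partial isometry `v`
with `v* v = p` and `v v* ≤ p` lies in `p A p ⊆ B`.) -/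
def IsPurelyInfiniteSimple (A : Type*) [NonUnitalCStarAlgebra A] [PartialOrder A]
    [StarOrderedRing A] : Prop :=
  IsSimpleCStarAlgebra A ∧
    ∀ B : NonUnitalStarSubalgebra ℂ A, IsHereditaryCStarSubalgebra B → B ≠ ⊥ →
      ∃ p ∈ B, IsInfiniteProjection p

/-! Only 0 < β < 1 needs work. Pure infiniteness gives a partial isometry w from q onto a proper
subprojection of p (`IsPurelyInfiniteSimple.exists_mvNEquiv_lt`). In the 2×2 matrices generated by
w, diag(α, β) is a projection plus α + β - 1 times a rank one projection zz*
(`exists_smul_add_smul_eq`). Thus αp + βq is a projection plus α(p - ww*) + (α + β - 1)zz*, of the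
same form because p - ww* is nonzero and orthogonal to zz*. The small coefficient has grown by α -
1, so finitely many rounds bring it to at least 1, where the hypothesis on multiples of projections
finishes. -/

theorem IsFiniteSumOfProjections.add {A : Type*} [NonUnitalCStarAlgebra A] {a b : A}
    (ha : IsFiniteSumOfProjections a) (hb : IsFiniteSumOfProjections b) :
    IsFiniteSumOfProjections (a + b) := by
  obtain ⟨m, r, hr, rfl⟩ := ha
  obtain ⟨n, s, hs, rfl⟩ := hb
  refine ⟨m + n, Fin.append r s, fun i => ?_, by simp [Fin.sum_univ_add]⟩
  induction i using Fin.addCases <;> simp [hr, hs]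

theorem IsStarProjection.isFiniteSumOfProjections {A : Type*} [NonUnitalCStarAlgebra A] {p : A}
    (hp : IsStarProjection p) : IsFiniteSumOfProjections p :=
  ⟨1, fun _ => p, fun _ => hp, by simp⟩

/-! ### Partial isometries and projections -/

section PartialIsometry

variable {A : Type*} [NonUnitalCStarAlgebra A]

/-- A partial isometry absorbs its source projection. -/
theorem IsStarProjection.mul_eq_of_star_mul_self_eq {v p : A} (hp : IsStarProjection p)
    (hv : star v * v = p) : v * p = v := by
  have hps : star p = p := hp.isSelfAdjoint
  have hpp : p * p = p := hp.isIdempotentElem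
  rw [← sub_eq_zero, ← CStarRing.star_mul_self_eq_zero_iff]
  have : star (v * p - v) * (v * p - v)
      = p * (star v * v) * p - p * (star v * v) - (star v * v) * p + star v * v := by
    simp only [star_sub, star_mul, hps]
    noncomm_ring
  rw [this, hv, hpp, hpp]
  abel

/-- The range of a partial isometry is a projection. -/
theorem IsStarProjection.mul_star_self {v p : A} (hp : IsStarProjection p)
    (hv : star v * v = p) : IsStarProjection (v * star v) where
  isIdempotentElem := by
    rw [IsIdempotentElem, mul_assoc, ← mul_assoc (star v), hv, ← mul_assoc,
      hp.mul_eq_of_star_mul_self_eq hv]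
  isSelfAdjoint := IsSelfAdjoint.mul_star_self v

theorem IsStarProjection.mul_comm_eq {p q r : A} (hp : IsStarProjection p)
    (hq : IsStarProjection q) (hr : IsStarProjection r) (h : p * q = r) : q * p = r := by
  have := congrArg star h
  rwa [star_mul, hp.isSelfAdjoint.star_eq, hq.isSelfAdjoint.star_eq,
    hr.isSelfAdjoint.star_eq] at this

end PartialIsometry

/-! ### Corners are hereditary -/

section Corner

variable {A : Type*} [NonUnitalCStarAlgebra A]

/-- The corner `p A p` of a projection `p`. -/
def cornerSubalgebra (p : A) (hp : IsStarProjection p) : NonUnitalStarSubalgebra ℂ A where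
  carrier := {x | p * x = x ∧ x * p = x}
  add_mem' := fun hx hy => ⟨by rw [mul_add, hx.1, hy.1], by rw [add_mul, hx.2, hy.2]⟩
  zero_mem' := by simp
  mul_mem' := fun hx hy => ⟨by rw [← mul_assoc, hx.1], by rw [mul_assoc, hy.2]⟩
  smul_mem' := fun c x hx => ⟨by rw [mul_smul_comm, hx.1], by rw [smul_mul_assoc, hx.2]⟩
  star_mem' := fun {x} hx => by
    have h1 := congrArg star hx.1
    have h2 := congrArg star hx.2
    rw [star_mul, hp.isSelfAdjoint.star_eq] at h1 h2
    exact ⟨h2, h1⟩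

theorem isHereditaryCStarSubalgebra_cornerSubalgebra [PartialOrder A] [StarOrderedRing A]
    (p : A) (hp : IsStarProjection p) :
    IsHereditaryCStarSubalgebra (cornerSubalgebra p hp) := by
  have hps : star p = p := hp.isSelfAdjoint
  have hpp : p * p = p := hp.isIdempotentElem
  refine ⟨(isClosed_eq (by fun_prop) continuous_id).inter
    (isClosed_eq (by fun_prop) continuous_id), fun a b ha hab hb => ?_⟩
  obtain ⟨c, hc⟩ := CStarAlgebra.nonneg_iff_eq_star_mul_self.mp ha
  obtain ⟨e, he⟩ := CStarAlgebra.nonneg_iff_eq_star_mul_self.mp (sub_nonneg.mpr hab)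
  have key : ∀ x : A, star (x - x * p) * (x - x * p)
      = star x * x - p * (star x * x) - star x * x * p + p * (star x * x) * p := by
    intro x
    simp only [star_sub, star_mul, hps]
    noncomm_ring
  -- Compressing b = c*c + e*e by 1 - p kills b, so both positive terms vanish.
  have hsum : star (c - c * p) * (c - c * p) + star (e - e * p) * (e - e * p) = 0 := by
    obtain ⟨hb1, hb2⟩ : p * b = b ∧ b * p = b := hb
    rw [key, key, ← hc, ← he]
    simp only [mul_sub, sub_mul, hb1, hb2]
    abel
  have hc0 : c - c * p = 0 := by
    rw [← CStarRing.star_mul_self_eq_zero_iff]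
    exact ((add_eq_zero_iff_of_nonneg (star_mul_self_nonneg _) (star_mul_self_nonneg _)).mp
      hsum).1
  have hcp : c * p = c := (sub_eq_zero.mp hc0).symm
  have hpc : p * star c = star c := by simpa [hps] using congrArg star hcp
  exact ⟨by rw [hc, ← mul_assoc, hpc], by rw [hc, mul_assoc, hcp]⟩

end Corner

/-- If a projection `q` of a unital C*-algebra is approximated by a product `w * z`, then
multiplying `z` on the right turns it into a partial isometry with source `q`. -/
theorem exists_star_mul_self_eq_of_norm_sub_mul_lt_one {B : Type*} [CStarAlgebra B] {q w z : B}
    (hq : IsStarProjection q) (h : ‖q - w * z‖ < 1) :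
    ∃ g : B, star (z * g) * (z * g) = q := by
  let _ := CStarAlgebra.spectralOrder B
  let _ := CStarAlgebra.spectralOrderedRing B
  have hqs : star q = q := hq.isSelfAdjoint
  have hqq : q * q = q := hq.isIdempotentElem
  have hx : ‖q * (q - w * z) * q‖ < 1 := by
    have hn : ‖q‖ ≤ 1 := hq.norm_le
    calc ‖q * (q - w * z) * q‖ ≤ ‖q‖ * ‖q - w * z‖ * ‖q‖ := norm_mul₃_le
      _ ≤ 1 * ‖q - w * z‖ * 1 := by gcongr
      _ < 1 := by simpa using h
  obtain ⟨u, hu⟩ := isUnit_one_sub_of_norm_lt_one hx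
  -- Inverting u makes zq left invertible relative to q.
  have huq : (u : B) * q = q * w * (z * q) := by
    rw [hu]
    simp only [mul_sub, sub_mul, one_mul, mul_assoc, hqq]
    abel
  set z₀ := z * q with hz₀
  set w₀ := (↑u⁻¹ : B) * (q * w) with hw₀
  have hwz : w₀ * z₀ = q := by
    rw [hw₀, mul_assoc, ← huq, Units.inv_mul_cancel_left]
  have hzq : z₀ * q = z₀ := by rw [hz₀, mul_assoc, hqq]
  have hqz : q * star z₀ = star z₀ := by simpa [hqs] using congrArg star hzq
  -- Adding 1 - q makes z₀*z₀, invertible only in the corner of q, invertible in B; then z₀d^(-1/2)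
  -- is the polar part.
  set d := 1 - q + star z₀ * z₀ with hd
  have hd0 : 0 ≤ d := add_nonneg hq.one_sub.nonneg (star_mul_self_nonneg _)
  have hle : q ≤ ‖star w₀ * w₀‖ • (star z₀ * z₀) := by
    have := CStarAlgebra.star_left_conjugate_le_norm_smul (a := z₀) (b := star w₀ * w₀)
      (IsSelfAdjoint.star_mul_self w₀)
    have e : star z₀ * (star w₀ * w₀) * z₀ = q := by
      have e' : star z₀ * (star w₀ * w₀) * z₀ = star (w₀ * z₀) * (w₀ * z₀) := by
        rw [star_mul w₀ z₀]
        simp only [mul_assoc]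
      rw [e', hwz, hqs, hqq]
    rwa [e] at this
  set c := ‖star w₀ * w₀‖ with hc
  have hc0 : 0 ≤ c := norm_nonneg _
  have h1 : (1 : B) ≤ (c + 1) • d := by
    have : (c + 1) • d = 1 + (c • (1 - q) + (c • (star z₀ * z₀) - q) + star z₀ * z₀) := by
      rw [hd]
      simp only [add_smul, smul_add, one_smul]
      abel
    rw [this]
    exact le_add_of_nonneg_right (add_nonneg (add_nonneg
      (smul_nonneg hc0 hq.one_sub.nonneg) (sub_nonneg.mpr hle)) (star_mul_self_nonneg _))
  have hdu : IsUnit d := by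
    have h2 : IsUnit ((c + 1) • d) := CStarAlgebra.isUnit_of_le 1 h1
    have hne : c + 1 ≠ 0 := by positivity
    exact (isUnit_smul_iff (Units.mk0 (c + 1) hne) d).mp h2
  have hdp : IsStrictlyPositive d := hdu.isStrictlyPositive hd0
  have hqd : q * d = star z₀ * z₀ := by
    rw [hd, mul_add, mul_sub, mul_one, hqq, ← mul_assoc, hqz]
    abel
  have hdq : d * q = star z₀ * z₀ := by
    rw [hd, add_mul, sub_mul, one_mul, hqq, mul_assoc, hzq]
    abel
  set g := d ^ (-(1 / 2) : ℝ) with hg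
  have hgs : star g = g := (CFC.rpow_nonneg (a := d)).isSelfAdjoint
  have hgq : g * q = q * g := by
    have : Commute d q := hdq.trans hqd.symm
    exact (this.cfc_nnreal _).eq
  have hgg : d * g * g = 1 := by
    rw [mul_assoc, hg, ← CFC.rpow_add hdu]
    convert CFC.rpow_mul_rpow_neg (a := d) 1 using 2
    · rw [CFC.rpow_one d]
    · norm_num
  refine ⟨q * g, ?_⟩
  have hcomm : g * d = d * g := ((Commute.refl d).cfc_nnreal _).eq
  have hzg : z * (q * g) = z₀ * g := by rw [hz₀, mul_assoc]
  calc star (z * (q * g)) * (z * (q * g)) = g * (star z₀ * z₀) * g := by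
        rw [hzg, star_mul, hgs]
        simp only [mul_assoc]
    _ = q * (d * g * g) := by
        rw [← hqd, ← mul_assoc, hgq, mul_assoc q, hcomm, mul_assoc]
    _ = q := by rw [hgg, mul_one]

/-! ### Comparison of projections -/

section PurelyInfinite

variable {A : Type*} [NonUnitalCStarAlgebra A]

/-- The nonunital version of `exists_star_mul_self_eq_of_norm_sub_mul_lt_one`. -/
theorem exists_mvNEquiv_of_norm_sub_mul_lt_one {q w z r : A} (hq : IsStarProjection q)
    (h : ‖q - w * z‖ < 1) (hrz : r * z = z) :
    ∃ v : A, star v * v = q ∧ r * v = v := by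
  have hq' : IsStarProjection (q : Unitization ℂ A) := hq.map (Unitization.inrNonUnitalStarAlgHom ℂ A)
  obtain ⟨g, hg⟩ := exists_star_mul_self_eq_of_norm_sub_mul_lt_one
    (w := (w : Unitization ℂ A)) (z := (z : Unitization ℂ A)) hq' (by
      rw [← Unitization.inr_mul, ← Unitization.inr_sub, Unitization.norm_inr]
      exact h)
  -- A is an ideal of its unitization.
  obtain ⟨v, hv⟩ : ∃ v : A, (v : Unitization ℂ A) = z * g :=
    ⟨((z : Unitization ℂ A) * g).snd, by ext <;> simp⟩
  refine ⟨v, Unitization.inr_injective (R := ℂ) ?_, Unitization.inr_injective (R := ℂ) ?_⟩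
  · rw [Unitization.inr_mul, Unitization.inr_star, hv, hg]
  · rw [Unitization.inr_mul, hv, ← mul_assoc, ← Unitization.inr_mul, hrz]

/-- In a simple C*-algebra every element is approximated by sums of elements `a * s * b`. -/
theorem IsSimpleCStarAlgebra.mem_closure_span (hA : IsSimpleCStarAlgebra A) {s : A}
    (hs : IsStarProjection s) (hs0 : s ≠ 0) (q : A) :
    q ∈ closure (Submodule.span ℂ {x : A | ∃ a b, x = a * s * b} : Set A) := by
  set S := Submodule.span ℂ {x : A | ∃ a b, x = a * s * b} with hS
  have hss : s * s = s := hs.isIdempotentElem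
  have hl : ∀ a x : A, x ∈ S → a * x ∈ S := by
    intro a x hx
    induction hx using Submodule.span_induction with
    | mem x hx =>
      obtain ⟨b, c, rfl⟩ := hx
      exact Submodule.subset_span ⟨a * b, c, by simp only [mul_assoc]⟩
    | zero => simp
    | add x y _ _ hx hy => rw [mul_add]; exact S.add_mem hx hy
    | smul c x _ hx => rw [mul_smul_comm]; exact S.smul_mem c hx
  have hr : ∀ a x : A, x ∈ S → x * a ∈ S := by
    intro a x hx
    induction hx using Submodule.span_induction with
    | mem x hx =>
      obtain ⟨b, c, rfl⟩ := hx
      exact Submodule.subset_span ⟨b, c * a, by simp only [mul_assoc]⟩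
    | zero => simp
    | add x y _ _ hx hy => rw [add_mul]; exact S.add_mem hx hy
    | smul c x _ hx => rw [smul_mul_assoc]; exact S.smul_mem c hx
  have hI := hA.2 S.topologicalClosure S.isClosed_topologicalClosure fun a x hx =>
    ⟨map_mem_closure (f := (a * ·)) (by fun_prop) hx (hl a),
      map_mem_closure (f := (· * a)) (by fun_prop) hx (hr a)⟩
  rcases hI with hI | hI
  · refine absurd ?_ hs0
    have : s ∈ S.topologicalClosure :=
      S.le_topologicalClosure (Submodule.subset_span ⟨s, s, by rw [hss, hss]⟩)
    rwa [hI, Submodule.mem_bot] at this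
  · have : q ∈ S.topologicalClosure := hI ▸ Submodule.mem_top
    exact this

/-- Sums of elements `a * s * b` factor through `r` when `r` is a projection with an isometry
`v` of `r A r` whose range is orthogonal to `s`. -/
theorem exists_eq_mul_of_mem_span {r s v : A} (hss : s * s = s) (hv : star v * v = r)
    (hsv : s * v = 0) (hvs : star v * s = 0) (hrv : r * v = v) (hrs : r * s = s) {t : A}
    (ht : t ∈ Submodule.span ℂ {x : A | ∃ a b, x = a * s * b}) :
    ∃ w z : A, t = w * z ∧ r * z = z := by
  -- Factorable elements are not visibly closed under addition, so the induction instead shows that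
  -- adding c • t preserves factorability.
  suffices ∀ (c : ℂ) (y : A), (∃ w z : A, y = w * z ∧ r * z = z) →
      ∃ w z : A, y + c • t = w * z ∧ r * z = z by
    simpa using this 1 0 ⟨0, 0, by simp⟩
  induction ht using Submodule.span_induction with
  | mem x hx =>
    obtain ⟨a, b, rfl⟩ := hx
    rintro c _ ⟨w, z, rfl, hz⟩
    -- A row times a column: v moves the old factor off s, so the cross terms vanish.
    refine ⟨w * star v + c • (a * s), v * z + s * b, ?_, ?_⟩
    · have h1 : w * star v * (v * z) = w * z := by
        rw [mul_assoc, ← mul_assoc (star v), hv, hz]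
      have h2 : w * star v * (s * b) = 0 := by
        rw [mul_assoc, ← mul_assoc (star v), hvs, zero_mul, mul_zero]
      have h3 : a * s * (v * z) = 0 := by
        rw [mul_assoc, ← mul_assoc s, hsv, zero_mul, mul_zero]
      have h4 : a * s * (s * b) = a * s * b := by
        rw [mul_assoc, ← mul_assoc s, hss, mul_assoc]
      rw [add_mul, mul_add, h1, h2, smul_mul_assoc, mul_add, h3, h4, add_zero, zero_add]
    · rw [mul_add, ← mul_assoc, ← mul_assoc, hrv, hrs]
  | zero => intro c y hy; simpa using hy
  | add x y _ _ hx hy =>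
    intro c y' hy'
    rw [smul_add, ← add_assoc]
    exact hy c _ (hx c y' hy')
  | smul d x _ hx =>
    intro c y hy
    rw [smul_smul]
    exact hx (c * d) y hy

/-- In a purely infinite simple C*-algebra every projection `q` is equivalent to a proper
subprojection of any nonzero projection `p`. -/
theorem IsPurelyInfiniteSimple.exists_mvNEquiv_lt [PartialOrder A] [StarOrderedRing A]
    (hA : IsPurelyInfiniteSimple A) {p q : A} (hp : IsStarProjection p) (hp0 : p ≠ 0)
    (hq : IsStarProjection q) :
    ∃ w : A, star w * w = q ∧ p * w = w ∧ w * star w ≠ p := by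
  have hne : cornerSubalgebra p hp ≠ ⊥ := by
    intro h
    have hpc : p ∈ cornerSubalgebra p hp := ⟨hp.isIdempotentElem, hp.isIdempotentElem⟩
    rw [h] at hpc
    exact hp0 (NonUnitalStarAlgebra.mem_bot.mp hpc)
  obtain ⟨r, ⟨hpr, -⟩, hr, e, he, hre, her, v, hv, hve⟩ :=
    hA.2 _ (isHereditaryCStarSubalgebra_cornerSubalgebra p hp) hne
  have hrr : r * r = r := hr.isIdempotentElem
  have hee : e * e = e := he.isIdempotentElem
  have her' : e * r = e := hr.mul_comm_eq he he hre
  have hvr : v * r = v := hr.mul_eq_of_star_mul_self_eq hv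
  have hev : e * v = v := by rw [← hve, mul_assoc, hv, hvr]
  have hrv : r * v = v := by rw [← hev, ← mul_assoc, hre]
  have hs : IsStarProjection (r - e) := he.sub_of_mul_eq_right hr hre
  have hsv : (r - e) * v = 0 := by rw [sub_mul, hrv, hev, sub_self]
  have hvs : star v * (r - e) = 0 := by
    have := congrArg star hsv
    rwa [star_mul, hs.isSelfAdjoint.star_eq, star_zero] at this
  have hrs : r * (r - e) = r - e := by rw [mul_sub, hrr, hre]
  obtain ⟨t, ht, hqt⟩ := Metric.mem_closure_iff.mp
    (hA.1.mem_closure_span hs (sub_ne_zero.mpr her.symm) q) 1 one_pos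
  obtain ⟨x, z, rfl, hz⟩ := exists_eq_mul_of_mem_span hs.isIdempotentElem hv hsv hvs hrv hrs ht
  rw [dist_eq_norm] at hqt
  obtain ⟨y, hy, hry⟩ := exists_mvNEquiv_of_norm_sub_mul_lt_one hq hqt hz
  -- Composing with v pushes the range of y below e, leaving room for r - e in p.
  have hw : star (v * y) * (v * y) = q := by
    rw [star_mul, mul_assoc, ← mul_assoc (star v), hv, hry, hy]
  refine ⟨v * y, hw, ?_, fun h => ?_⟩
  · rw [← mul_assoc, ← hrv, ← mul_assoc, hpr]
  · have hsp : (r - e) * p = 0 := by rw [← h, ← mul_assoc, ← mul_assoc, hsv, zero_mul, zero_mul]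
    have hps : p * (r - e) = r - e := by
      rw [mul_sub, hpr, ← hre, ← mul_assoc, hpr]
    have := hs.mul_comm_eq hp (IsStarProjection.zero A) hsp
    exact her (sub_eq_zero.mp (hps.symm.trans this)).symm

end PurelyInfinite

/-! ### Splitting 2×2 diagonal matrices -/

section RankOne

variable {A : Type*} [NonUnitalCStarAlgebra A]

/-- For a partial isometry `w` with orthogonal source and range and `x² + y² = 1`, the element
`x w + y q` is a partial isometry with source `q`. -/
theorem star_mul_self_smul_add_smul {w q : A} (hq : IsStarProjection q) (hw : star w * w = q)
    (hqw : q * w = 0) {x y : ℝ} (hxy : x ^ 2 + y ^ 2 = 1) :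
    star (x • w + y • q) * (x • w + y • q) = q := by
  have hwq : star w * q = 0 := by
    have := congrArg star hqw
    rwa [star_mul, hq.isSelfAdjoint.star_eq, star_zero] at this
  simp only [star_add, star_smul, star_trivial, hq.isSelfAdjoint.star_eq, add_mul, mul_add,
    smul_mul_assoc, mul_smul_comm, hw, hqw, hwq, hq.isIdempotentElem.eq, smul_zero, add_zero,
    zero_add, smul_smul]
  rw [← add_smul, ← pow_two, ← pow_two, hxy, one_smul]

theorem smul_add_smul_mul_star {w q : A} (hq : IsStarProjection q) (hw : star w * w = q)
    (x y : ℝ) :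
    (x • w + y • q) * star (x • w + y • q)
      = x ^ 2 • (w * star w) + (x * y) • (w + star w) + y ^ 2 • q := by
  have hwq : w * q = w := hq.mul_eq_of_star_mul_self_eq hw
  have hqw : q * star w = star w := by
    simpa [hq.isSelfAdjoint.star_eq] using congrArg star hwq
  simp only [star_add, star_smul, star_trivial, hq.isSelfAdjoint.star_eq, add_mul, mul_add,
    smul_mul_assoc, mul_smul_comm, hwq, hqw, hq.isIdempotentElem.eq]
  module

/-- A diagonal matrix `diag(α, β)` with `0 < β < 1 < α` is the sum of a rank one projection and a
multiple of a rank one projection. -/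
theorem exists_unit_vectors_of_lt_one_lt {α β : ℝ} (hα : 1 < α) (hβ : 0 < β) (hβ1 : β < 1) :
    ∃ x y x' y' : ℝ, x ^ 2 + y ^ 2 = 1 ∧ x' ^ 2 + y' ^ 2 = 1 ∧
      x ^ 2 + (α + β - 1) * x' ^ 2 = α ∧ x * y + (α + β - 1) * (x' * y') = 0 ∧
      y ^ 2 + (α + β - 1) * y' ^ 2 = β := by
  have h1 : 0 < α - β := by linarith
  have h2 : 0 < α - 1 := by linarith
  have h3 : 0 < 1 - β := by linarith
  have h4 : 0 < α + β - 1 := by linarith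
  have h5 : 0 < α := by linarith
  -- Subtracting the projection onto a unit vector (x, y) leaves rank one iff x²/α + y²/β = 1; this
  -- fixes x² and y². The remainder has trace α + β - 1, and the minus sign cancels the off-diagonal
  -- entries.
  refine ⟨√(α * (1 - β)) / √(α - β), √(β * (α - 1)) / √(α - β),
    √(α * (α - 1)) / √((α - β) * (α + β - 1)), -(√(β * (1 - β)) / √((α - β) * (α + β - 1))),
    ?_, ?_, ?_, ?_, ?_⟩
  · simp only [div_pow]
    rw [Real.sq_sqrt (by positivity), Real.sq_sqrt (by positivity), Real.sq_sqrt (by positivity)]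
    field_simp
    ring
  · simp only [div_pow, neg_sq]
    rw [Real.sq_sqrt (by positivity), Real.sq_sqrt (by positivity), Real.sq_sqrt (by positivity)]
    field_simp
    ring
  · simp only [div_pow]
    rw [Real.sq_sqrt (by positivity), Real.sq_sqrt (by positivity), Real.sq_sqrt (by positivity),
      Real.sq_sqrt (by positivity)]
    field_simp
    ring
  · have e1 : √(α * (1 - β)) * √(β * (α - 1)) = √(α * (α - 1)) * √(β * (1 - β)) := by
      rw [← Real.sqrt_mul (by positivity), ← Real.sqrt_mul (by positivity)]
      congr 1
      ring
    rw [div_mul_div_comm, e1, mul_neg, div_mul_div_comm, Real.mul_self_sqrt (by positivity),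
      Real.mul_self_sqrt (by positivity)]
    field_simp
    ring
  · simp only [div_pow, neg_sq]
    rw [Real.sq_sqrt (by positivity), Real.sq_sqrt (by positivity), Real.sq_sqrt (by positivity),
      Real.sq_sqrt (by positivity)]
    field_simp
    ring

/-- For a partial isometry `w` with source `q` and orthogonal range, `α w w* + β q` with
`0 < β < 1 < α` is the sum of a projection and `α + β - 1` times a projection whose supporting
partial isometry `z` is a combination of `w` and `q`. -/
theorem exists_smul_add_smul_eq {w q : A} (hq : IsStarProjection q) (hw : star w * w = q)
    (hqw : q * w = 0) {α β : ℝ} (hα : 1 < α) (hβ : 0 < β) (hβ1 : β < 1) :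
    ∃ (e z : A) (x y : ℝ), IsStarProjection e ∧ z = x • w + y • q ∧ star z * z = q ∧
      α • (w * star w) + β • q = e + (α + β - 1) • (z * star z) := by
  obtain ⟨x, y, x', y', h1, h2, h3, h4, h5⟩ := exists_unit_vectors_of_lt_one_lt hα hβ hβ1
  refine ⟨(x • w + y • q) * star (x • w + y • q), x' • w + y' • q, x', y',
    hq.mul_star_self (star_mul_self_smul_add_smul hq hw hqw h1), rfl,
    star_mul_self_smul_add_smul hq hw hqw h2, ?_⟩
  rw [smul_add_smul_mul_star hq hw, smul_add_smul_mul_star hq hw]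
  have : x ^ 2 • (w * star w) + (x * y) • (w + star w) + y ^ 2 • q + (α + β - 1) •
      (x' ^ 2 • (w * star w) + (x' * y') • (w + star w) + y' ^ 2 • q)
      = (x ^ 2 + (α + β - 1) * x' ^ 2) • (w * star w)
        + (x * y + (α + β - 1) * (x' * y')) • (w + star w)
        + (y ^ 2 + (α + β - 1) * y' ^ 2) • q := by
    module
  rw [this, h3, h4, h5, zero_smul, add_zero]

end RankOne

/-- Here k bounds the number of splittings until the second coefficient reaches 1; p, q and β change
at each one, hence are quantified inside. -/
theorem isFiniteSumOfProjections_smul_add_smul {A : Type*} [NonUnitalCStarAlgebra A]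
    [PartialOrder A] [StarOrderedRing A] (hA : IsPurelyInfiniteSimple A)
    (hproj : ∀ α : ℝ, 1 < α → ∀ p : A, IsStarProjection p → IsFiniteSumOfProjections (α • p))
    {α : ℝ} (hα : 1 < α) (k : ℕ) :
    ∀ (p q : A) (β : ℝ), IsStarProjection p → IsStarProjection q → p ≠ 0 → q ≠ 0 → p * q = 0 →
      0 < β → 1 ≤ β + k * (α - 1) → IsFiniteSumOfProjections (α • p + β • q) := by
  induction k with
  | zero =>
    intro p q β hp hq _ _ _ _ hk
    rcases (by simpa using hk : 1 ≤ β).eq_or_lt with rfl | h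
    · rw [one_smul]
      exact (hproj α hα p hp).add hq.isFiniteSumOfProjections
    · exact (hproj α hα p hp).add (hproj β h q hq)
  | succ k ih =>
    intro p q β hp hq hp0 hq0 hpq hβ hk
    rcases lt_trichotomy β 1 with h | rfl | h
    · obtain ⟨w, hw, hpw, hwp⟩ := hA.exists_mvNEquiv_lt hp hp0 hq
      have hqp : q * p = 0 := hp.mul_comm_eq hq (IsStarProjection.zero A) hpq
      have hqw : q * w = 0 := by rw [← hpw, ← mul_assoc, hqp, zero_mul]
      have hwq : w * q = w := hq.mul_eq_of_star_mul_self_eq hw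
      obtain ⟨e, z, x, y, he, hz, hzq, heq⟩ := exists_smul_add_smul_eq hq hw hqw hα hβ h
      have hww : IsStarProjection (w * star w) := hq.mul_star_self hw
      have hd : IsStarProjection (p - w * star w) :=
        hww.sub_of_mul_eq_right hp (by rw [← mul_assoc, hpw])
      have hz0 : z * star z ≠ 0 := by
        intro h0
        rw [CStarRing.mul_star_self_eq_zero_iff] at h0
        exact hq0 (by rw [← hzq, h0, mul_zero])
      have hdz : (p - w * star w) * (z * star z) = 0 := by
        have hd1 : (p - w * star w) * w = 0 := by
          rw [sub_mul, hpw, mul_assoc, hw, hwq, sub_self]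
        have hd2 : (p - w * star w) * q = 0 := by
          have : star w * q = 0 := by
            simpa [hq.isSelfAdjoint.star_eq] using congrArg star hqw
          rw [sub_mul, hpq, mul_assoc, this, mul_zero, sub_self]
        rw [← mul_assoc, hz, mul_add, mul_smul_comm, mul_smul_comm, hd1, hd2]
        simp
      -- Properness of ww* in p keeps the first projection nonzero.
      have hrec := ih (p - w * star w) (z * star z) (α + β - 1) hd (hq.mul_star_self hzq)
        (sub_ne_zero.mpr hwp.symm) hz0 hdz (by linarith) (by push_cast at hk; linarith)
      have : α • p + β • q
          = e + (α • (p - w * star w) + (α + β - 1) • (z * star z)) := by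
        rw [add_left_comm, ← heq, smul_sub]
        abel
      rw [this]
      exact he.isFiniteSumOfProjections.add hrec
    · rw [one_smul]
      exact (hproj α hα p hp).add hq.isFiniteSumOfProjections
    · exact (hproj α hα p hp).add (hproj β h q hq)

theorem lemmaL {A : Type*} [NonUnitalCStarAlgebra A] [PartialOrder A] [StarOrderedRing A]
    (hA : IsPurelyInfiniteSimple A)
    (hproj : ∀ α : ℝ, 1 < α → ∀ p : A, IsStarProjection p → IsFiniteSumOfProjections (α • p))
    (p q : A) (hp : IsStarProjection p) (hq : IsStarProjection q) (hp0 : p ≠ 0) (hq0 : q ≠ 0)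
    (hpq : p * q = 0) (α β : ℝ) (hα : 1 < α) (hβ : 0 ≤ β) :
    IsFiniteSumOfProjections (α • p + β • q) := by
  rcases hβ.eq_or_lt with rfl | hβ
  · rw [zero_smul, add_zero]
    exact hproj α hα p hp
  · obtain ⟨k, hk⟩ := exists_nat_ge (1 / (α - 1))
    rw [div_le_iff₀ (by linarith)] at hk
    exact isFiniteSumOfProjections_smul_add_smul hA hproj hα k p q β hp hq hp0 hq0 hpq hβ
      (by linarith)
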